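/- Let $(X,\mathcal A,\mu,T)$ be an ergodic probability-preserving system. For $A\in\mathcal A$ let $\varphi_A(x):=\min\{n\ge1:T^nx\in A\}\in\mathbb N\cup\{\infty\}$, with $\min\emptyset:=\infty$, be the first hitting time of $A$ (it is finite a.e. if $\mu(A)>0$). Let $Y\in\mathcal A$ with $\mu(Y)>0$, put $\mu_Y(A):=\mu(Y\cap A)/\mu(Y)$, let $T_Yx:=T^{\varphi_Y(x)}x$ be the (a.e. defined) first-return map of $Y$, and for measurable $A\subseteq Y$ let $\varphi^Y_A(x):=\inf\{j\ge1:T_Y^jx\in A\}$, $x\in Y$, be the hitting time of $A$ under $T_Y$. A sequence $(A_k)_{k\ge1}$ in $\mathcal A$ is called asymptotically rare if $\mu(A_k)>0$ for all $k$ and $\mu(A_k)\to0$. For a probability $\nu$ on $(X,\mathcal A)$, $R_k\overset{\nu}{\Longrightarrow}\mathsf R$ denotes convergence in law, in $[0,\infty]$, of the $R_k$, regarded as random variables on $(X,\mathcal A,\nu)$, to $\mathsf R$, and $\overset{\nu}{\longrightarrow}$ denotes convergence in $\nu$-measure. Let $(E_k)_{k\ge1}$ be a sequence of asymptotically rare events,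 and let $(E_k')_{k\ge1}$ be a sequence of measurable subsets of $Y$ such that for every $k\ge1$ points of $Y$ can only reach $E_k$ via $E_k'$, that is, for every $n\ge0$ and a.e. $x\in Y$, $T^nx\in E_k$ implies $T^jx\in E_k'$ for some $j\in\{0,\dots,n\}$. Let $\mathsf R$ be any random variable with values in $[0,\infty]$. (a) If $$\mu(E_k')\,(\varphi_{E_k}-\varphi_{E_k'})\overset{\mu_Y}{\longrightarrow}0\quad\text{as }k\to\infty,\tag{$*$}$$ then $(E_k')$ is asymptotically rare, and $$\mu_Y(E_k')\,\varphi^Y_{E_k'}\overset{\mu_Y}{\Longrightarrow}\mathsf R\quad\text{as }k\to\infty$$ holds if and only if $$\mu(E_k')\,\varphi_{E_k}\overset{\mu}{\Longrightarrow}\mathsf R\quad\text{as }k\to\infty.$$ (b) If there is a constant $M\ge0$ such that $E_k'\subseteq\bigcup_{m=0}^{M}T^{-m}E_k$ for all $k\ge1$, then $(E_k')$ satisfies $(*)$. -/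

import Mathlib

open MeasureTheory ProbabilityTheory Filter Topology
open scoped ENNReal

namespace HittingTimes

variable {X : Type*}

/-- The first hitting time `φ_A(x) = min {n ≥ 1 : T^n x ∈ A}`, equal to `∞` if there is
no such `n`. -/
noncomputable def hittingTime (T : X → X) (A : Set X) (x : X) : ℕ∞ :=
  ⨅ (n : ℕ) (_ : 1 ≤ n ∧ T^[n] x ∈ A), (n : ℕ∞)

/-- The map `T_Y x = T^{φ_Y(x)} x`, whose restriction to `Y` is the first-return map of `Y`.
On the set `{φ_Y = ∞}`, which is a null set whenever `T` is ergodic and probability-preserving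
and `Y` is measurable of positive measure, it is the identity by convention. -/
noncomputable def inducedMap (T : X → X) (Y : Set X) (x : X) : X :=
  T^[(hittingTime T Y x).toNat] x

/-- The hitting time `φ^Y_A(x) = inf {j ≥ 1 : T_Y^j x ∈ A}` of `A ⊆ Y` under the first-return
map of `Y`. Only its values at points `x` of `Y` are relevant. -/
noncomputable def inducedHittingTime (T : X → X) (Y A : Set X) (x : X) : ℕ∞ :=
  hittingTime (inducedMap T Y) A x

variable [MeasurableSpace X]

/-- A sequence of asymptotically rare events: measurable sets of positive measure whose measures
tend to `0`. -/
structure AsymptoticallyRare (μ : Measure X) (E : ℕ → Set X) : Prop where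
  measurableSet : ∀ k, MeasurableSet (E k)
  pos : ∀ k, 0 < μ (E k)
  tendsto_zero : Tendsto (fun k => μ (E k)) atTop (𝓝 0)

/-- Points of `Y` can only reach `E` via `E'`: for every `n ≥ 0` and almost every `x ∈ Y`,
`T^n x ∈ E` implies that `T^j x ∈ E'` for some `j ∈ {0, …, n}`. -/
def OnlyReachVia (μ : Measure X) (T : X → X) (Y E E' : Set X) : Prop :=
  ∀ n : ℕ, ∀ᵐ x ∂μ, x ∈ Y → T^[n] x ∈ E → ∃ j ≤ n, T^[j] x ∈ E'

/-- `μ(E'_k) (φ_{E_k} - φ_{E'_k}) → 0` in measure with respect to the normalized restriction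
`μ_Y` of `μ` to `Y`. The hitting times of sets of positive measure are finite almost everywhere
for an ergodic probability-preserving map, so the difference can be taken in `ℝ`. -/
def HittingTimesClose (μ : Measure X) (T : X → X) (Y : Set X) (E E' : ℕ → Set X) : Prop :=
  TendstoInMeasure μ[|Y]
    (fun k x => (μ (E' k)).toReal *
      (((hittingTime T (E k) x).toNat : ℝ) - ((hittingTime T (E' k) x).toNat : ℝ)))
    atTop (fun _ => 0)

end HittingTimes

/-! Three comparisons carry part (a). Up to a large time `n` an orbit visits `Y` about `n * μ Y`
times, by Birkhoff's theorem, and the normalization of `μ[|Y]` cancels exactly this factor. Hitting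
times of rare sets are large with high probability, so `μ[|Y] (E' k) * inducedHittingTime` and `μ
(E' k) * hittingTime T (E' k)` are asymptotically equal (`tendsto_measure_compactify_induced`).
Closeness of hitting times then replaces `E' k` by `E k` under `μ[|Y]`
(`HittingTimesClose.tendsto_measure_compactify`). Finally `μ[|Y]` is replaced by `μ`
(`tendstoInDistribution_cond_iff`): off the small set `T ⁻¹' E k`, passing from `x` to `T x` lowers
the hitting time of `E k` by one, so the rescaled time is asymptotically invariant. Averaging along
orbits then makes it asymptotically independent of the density of `μ[|Y]`. Errors are measured
through `x ↦ 1 / (1 + x)`, which is Lipschitz and insensitive to small relative errors even at large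
values. Rarity of `E'` holds because a set with few quick returns has small measure, while quick
returns to a non-small `E' k` would separate the two hitting times. In part (b), off `E' k`, the
hitting time of `E k` exceeds that of `E' k` by between `0` and `M`. -/

namespace HittingTimes

/-! ### Birkhoff's theorem through maximal sums -/

section Birkhoff

variable {X : Type*}

/-- The running maximum of the Birkhoff sums `S₁ f, …, Sₙ₊₁ f`, defined by recursion. -/
noncomputable def maxBirkhoff (T : X → X) (f : X → ℝ) : ℕ → X → ℝ
  | 0, x => f x
  | n + 1, x => f x + max 0 (maxBirkhoff T f n (T x))

lemma maxBirkhoff_le_succ (T : X → X) (f : X → ℝ) (n : ℕ) (x : X) :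
    maxBirkhoff T f n x ≤ maxBirkhoff T f (n + 1) x := by
  induction n generalizing x with
  | zero => simp [maxBirkhoff]
  | succ n ih =>
    rw [maxBirkhoff, maxBirkhoff]
    have := ih (T x)
    gcongr

lemma maxBirkhoff_mono (T : X → X) (f : X → ℝ) (x : X) :
    Monotone fun n => maxBirkhoff T f n x :=
  monotone_nat_of_le_succ fun n => maxBirkhoff_le_succ T f n x

lemma birkhoffSum_le_maxBirkhoff (T : X → X) (f : X → ℝ) (n : ℕ) (x : X) :
    birkhoffSum T f (n + 1) x ≤ maxBirkhoff T f n x := by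
  induction n generalizing x with
  | zero => simp [maxBirkhoff]
  | succ n ih =>
    rw [birkhoffSum_succ', maxBirkhoff]
    have := ih (T x)
    gcongr
    exact this.trans (le_max_right _ _)

/-- Makes the set where the sums are bounded above strictly invariant, so that ergodicity leaves
only a null or a full set. -/
lemma bddAbove_maxBirkhoff_comp_iff (T : X → X) (f : X → ℝ) (x : X) :
    BddAbove (Set.range fun n => maxBirkhoff T f n (T x)) ↔
      BddAbove (Set.range fun n => maxBirkhoff T f n x) := by
  constructor
  · rintro ⟨B, hB⟩
    refine ⟨f x + max 0 B, ?_⟩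
    rintro _ ⟨n, rfl⟩
    refine (maxBirkhoff_le_succ T f n x).trans ?_
    rw [maxBirkhoff]
    have : maxBirkhoff T f n (T x) ≤ B := hB ⟨n, rfl⟩
    gcongr
  · rintro ⟨B, hB⟩
    refine ⟨B - f x, ?_⟩
    rintro _ ⟨n, rfl⟩
    have : maxBirkhoff T f (n + 1) x ≤ B := hB ⟨n + 1, rfl⟩
    rw [maxBirkhoff] at this
    have h2 := le_max_right 0 (maxBirkhoff T f n (T x))
    show maxBirkhoff T f n (T x) ≤ B - f x
    linarith

lemma birkhoffSum_sub_const (T : X → X) (f : X → ℝ) (c : ℝ) (n : ℕ) (x : X) :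
    birkhoffSum T (fun y => f y - c) n x = birkhoffSum T f n x - n * c := by
  simp [birkhoffSum, Finset.sum_sub_distrib]

variable [MeasurableSpace X] {μ : Measure X} {T : X → X} {f : X → ℝ}

lemma measurable_maxBirkhoff (hT : Measurable T) (hf : Measurable f) (n : ℕ) :
    Measurable (maxBirkhoff T f n) := by
  induction n with
  | zero => exact hf
  | succ n ih => exact hf.add (measurable_const.max (ih.comp hT))

lemma integrable_maxBirkhoff (hT : MeasurePreserving T μ μ) (hf : Integrable f μ) (n : ℕ) :
    Integrable (maxBirkhoff T f n) μ := by
  induction n with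
  | zero => exact hf
  | succ n ih =>
    exact hf.add ((integrable_zero X ℝ μ).sup (hT.integrable_comp_of_integrable ih))

/-- If `f` has negative mean, its Birkhoff sums along an ergodic map are a.e. bounded above. -/
theorem ae_bddAbove_birkhoffSum [IsFiniteMeasure μ] (hT : Ergodic T μ) (hfm : Measurable f)
    (hf : Integrable f μ) (hneg : ∫ x, f x ∂μ < 0) :
    ∀ᵐ x ∂μ, BddAbove (Set.range fun n => birkhoffSum T f n x) := by
  have hmeas := measurable_maxBirkhoff hT.measurable hfm
  have hset : MeasurableSet {x | BddAbove (Set.range fun n => maxBirkhoff T f n x)} :=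
    measurableSet_bddAbove_range hmeas
  have hdich := hT.toPreErgodic.ae_mem_or_ae_notMem hset
    (Set.ext fun x => bddAbove_maxBirkhoff_comp_iff T f x)
  rcases hdich with h | h
  · filter_upwards [h] with x hx
    obtain ⟨B, hB⟩ := hx
    refine ⟨max 0 B, ?_⟩
    rintro _ ⟨n, rfl⟩
    cases n with
    | zero => simp
    | succ n =>
      exact (birkhoffSum_le_maxBirkhoff T f n x).trans ((hB ⟨n, rfl⟩).trans (le_max_right _ _))
  · exfalso
    have hint := integrable_maxBirkhoff hT.toMeasurePreserving hf
    have hintT := fun n => hT.toMeasurePreserving.integrable_comp_of_integrable (hint n)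
    -- By the recursion the integrand is `f` plus the negative part of `maxBirkhoff T f n ∘ T`. That
    -- part is at most `|f ∘ T|`, since the maximum is at least its first term, and it vanishes
    -- eventually where the maxima are unbounded.
    have hlim : Tendsto (fun n => ∫ x, (maxBirkhoff T f (n + 1) x - maxBirkhoff T f n (T x)) ∂μ)
        atTop (𝓝 (∫ x, f x ∂μ)) := by
      refine tendsto_integral_of_dominated_convergence (fun x => |f x| + |f (T x)|)
        (fun n => ((hint (n + 1)).sub (hintT n)).aestronglyMeasurable)
        (hf.abs.add (hT.toMeasurePreserving.integrable_comp_of_integrable hf).abs) ?_ ?_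
      · intro n
        refine Eventually.of_forall fun x => ?_
        have h0 : f (T x) ≤ maxBirkhoff T f n (T x) := maxBirkhoff_mono T f (T x) (Nat.zero_le n)
        rw [maxBirkhoff, Real.norm_eq_abs, add_sub_assoc]
        refine (abs_add_le _ _).trans (add_le_add_right ?_ _)
        rcases max_cases 0 (maxBirkhoff T f n (T x)) with ⟨h1, h2⟩ | ⟨h1, h2⟩
        · rw [h1, zero_sub, abs_neg, abs_of_nonpos h2, abs_of_nonpos (h0.trans h2)]
          linarith
        · rw [h1, sub_self, abs_zero]
          positivity
      · filter_upwards [h] with x hx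
        have hx' : ¬ BddAbove (Set.range fun n => maxBirkhoff T f n (T x)) := fun h =>
          hx ((bddAbove_maxBirkhoff_comp_iff T f x).1 h)
        have htop := tendsto_atTop_atTop_of_monotone' (maxBirkhoff_mono T f (T x)) hx'
        refine tendsto_const_nhds.congr' ?_
        filter_upwards [htop.eventually_ge_atTop 0] with n hn
        rw [maxBirkhoff, max_eq_right hn]
        ring
    -- Invariance of `μ` removes `T` from the second term, and the maxima increase with `n`; hence
    -- the limit is nonnegative, against the negative mean.
    have hnonneg : 0 ≤ ∫ x, f x ∂μ := by
      refine ge_of_tendsto' hlim fun n => ?_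
      have hcomp : ∫ x, (maxBirkhoff T f n ∘ T) x ∂μ = ∫ x, maxBirkhoff T f n x ∂μ := by
        simp only [Function.comp_apply]
        rw [← integral_map hT.measurable.aemeasurable
          (hmeas n).aestronglyMeasurable, hT.map_eq]
      refine le_of_le_of_eq ?_ (integral_sub (hint (n + 1)) (hintT n)).symm
      rw [hcomp, sub_nonneg]
      exact integral_mono (hint n) (hint (n + 1)) fun x => maxBirkhoff_le_succ T f n x
    linarith

/-- For `d` strictly between the mean and `c`, the sums of `f - d` are bounded by some `B`, so the
sums of `f` are at most `B + n * d`, eventually below `n * c`. -/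
lemma ae_eventually_birkhoffAverage_lt [IsProbabilityMeasure μ] (hT : Ergodic T μ)
    (hfm : Measurable f) (hf : Integrable f μ) {c : ℝ} (hc : ∫ x, f x ∂μ < c) :
    ∀ᵐ x ∂μ, ∀ᶠ n in atTop, birkhoffAverage ℝ T f n x < c := by
  obtain ⟨d, hd1, hd2⟩ := exists_between hc
  have h := ae_bddAbove_birkhoffSum (f := fun x => f x - d) hT (hfm.sub_const d)
    (hf.sub (integrable_const d)) (by
      rw [integral_sub hf (integrable_const d)]; simpa using hd1)
  filter_upwards [h] with x hx
  obtain ⟨B, hB⟩ := hx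
  have hlim : Tendsto (fun n : ℕ => (n : ℝ) * (c - d)) atTop atTop :=
    tendsto_natCast_atTop_atTop.atTop_mul_const (sub_pos.2 hd2)
  filter_upwards [hlim.eventually_gt_atTop B, eventually_gt_atTop 0] with n hn hn0
  have h1 : birkhoffSum T (fun y => f y - d) n x ≤ B := hB ⟨n, rfl⟩
  rw [birkhoffSum_sub_const] at h1
  have hn0' : (0 : ℝ) < n := by exact_mod_cast hn0
  rw [birkhoffAverage, smul_eq_mul, inv_mul_lt_iff₀ hn0']
  linarith

/-- **Birkhoff's pointwise ergodic theorem** for an ergodic probability-preserving map. -/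
theorem ae_tendsto_birkhoffAverage [IsProbabilityMeasure μ] (hT : Ergodic T μ)
    (hfm : Measurable f) (hf : Integrable f μ) :
    ∀ᵐ x ∂μ, Tendsto (fun n => birkhoffAverage ℝ T f n x) atTop (𝓝 (∫ x, f x ∂μ)) := by
  obtain ⟨u, -, hu, hulim⟩ := exists_seq_strictAnti_tendsto (0 : ℝ)
  have h1 : ∀ᵐ x ∂μ, ∀ k, ∀ᶠ n in atTop, birkhoffAverage ℝ T f n x < (∫ x, f x ∂μ) + u k :=
    ae_all_iff.2 fun k => ae_eventually_birkhoffAverage_lt hT hfm hf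
      (lt_add_of_pos_right _ (hu k))
  have h2 : ∀ᵐ x ∂μ, ∀ k, ∀ᶠ n in atTop,
      birkhoffAverage ℝ T (-f) n x < (∫ x, (-f) x ∂μ) + u k :=
    ae_all_iff.2 fun k => ae_eventually_birkhoffAverage_lt hT hfm.neg hf.neg
      (lt_add_of_pos_right _ (hu k))
  filter_upwards [h1, h2] with x hx1 hx2
  rw [Metric.tendsto_atTop']
  intro ε hε
  obtain ⟨k, hk⟩ := (hulim.eventually_lt_const hε).exists
  obtain ⟨N, hN⟩ := eventually_atTop.1 ((hx1 k).and (hx2 k))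
  refine ⟨N, fun n hn => ?_⟩
  obtain ⟨h3, h4⟩ := hN n hn.le
  have h5 : birkhoffAverage ℝ T (-f) n x = - birkhoffAverage ℝ T f n x := by
    simp [birkhoffAverage, birkhoffSum]
  have h6 : ∫ x, (-f) x ∂μ = - ∫ x, f x ∂μ := integral_neg f
  rw [h5, h6] at h4
  rw [Real.dist_eq, abs_lt]
  constructor <;> linarith

end Birkhoff

/-! ### Hitting times: combinatorics, measurability, basic estimates -/

section HittingTime

variable {X : Type*} {T : X → X} {A Y : Set X} {x : X}

lemma natCast_le_hittingTime_iff {n : ℕ} :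
    (n : ℕ∞) ≤ hittingTime T A x ↔ ∀ m, 1 ≤ m → T^[m] x ∈ A → n ≤ m := by
  simp [hittingTime]

lemma hittingTime_le {n : ℕ} (hn : 1 ≤ n) (h : T^[n] x ∈ A) : hittingTime T A x ≤ n :=
  iInf₂_le n ⟨hn, h⟩

lemma hittingTime_le_natCast_iff {n : ℕ} :
    hittingTime T A x ≤ n ↔ ∃ m, 1 ≤ m ∧ m ≤ n ∧ T^[m] x ∈ A := by
  constructor
  · intro h
    by_contra! hc
    have h1 : ((n + 1 : ℕ) : ℕ∞) ≤ hittingTime T A x :=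
      natCast_le_hittingTime_iff.2 fun m hm hmA => by
        by_contra! hlt
        exact hc m hm (by omega) hmA
    have h2 : ((n + 1 : ℕ) : ℕ∞) ≤ n := h1.trans h
    norm_cast at h2
    omega
  · rintro ⟨m, hm, hmn, hmA⟩
    exact (hittingTime_le hm hmA).trans (by exact_mod_cast hmn)

lemma hittingTime_eq_natCast_iff {n : ℕ} :
    hittingTime T A x = n ↔ 1 ≤ n ∧ T^[n] x ∈ A ∧ ∀ m, 1 ≤ m → m < n → T^[m] x ∉ A := by
  rw [le_antisymm_iff, natCast_le_hittingTime_iff, hittingTime_le_natCast_iff]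
  constructor
  · rintro ⟨⟨m, hm, hmn, hmA⟩, h⟩
    obtain rfl : m = n := le_antisymm hmn (h m hm hmA)
    exact ⟨hm, hmA, fun k hk hkn hkA => absurd (h k hk hkA) (by omega)⟩
  · rintro ⟨h1, h2, h3⟩
    exact ⟨⟨n, h1, le_rfl, h2⟩, fun m hm hmA => by
      by_contra! hlt
      exact h3 m hm hlt hmA⟩

lemma hittingTime_ne_top_iff : hittingTime T A x ≠ ⊤ ↔ ∃ n, 1 ≤ n ∧ T^[n] x ∈ A := by
  constructor
  · intro h
    obtain ⟨n, hn⟩ := ENat.ne_top_iff_exists.1 h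
    obtain ⟨h1, h2, -⟩ := hittingTime_eq_natCast_iff.1 hn.symm
    exact ⟨n, h1, h2⟩
  · rintro ⟨n, h1, h2⟩ h
    simpa [h] using hittingTime_le h1 h2

/-- A point that does not hit `A` in one step hits it one step later than its image. -/
lemma hittingTime_eq_comp_add_one (h : T x ∉ A) :
    hittingTime T A x = hittingTime T A (T x) + 1 := by
  refine le_antisymm ?_ ?_
  · by_cases hx : hittingTime T A (T x) = ⊤
    · simp [hx]
    · obtain ⟨n, hn⟩ := ENat.ne_top_iff_exists.1 hx
      obtain ⟨h1, h2, -⟩ := hittingTime_eq_natCast_iff.1 hn.symm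
      rw [← hn]
      exact_mod_cast hittingTime_le (n := n + 1) (by omega) (by simpa using h2)
  · by_cases hx : hittingTime T A x = ⊤
    · simp [hx]
    · obtain ⟨n, hn⟩ := ENat.ne_top_iff_exists.1 hx
      obtain ⟨h1, h2, -⟩ := hittingTime_eq_natCast_iff.1 hn.symm
      rw [← hn]
      obtain ⟨m, rfl⟩ : ∃ m, n = m + 1 := ⟨n - 1, by omega⟩
      have hm : 1 ≤ m := by
        by_contra! h0
        obtain rfl : m = 0 := by omega
        exact h (by simpa using h2)
      have := hittingTime_le (x := T x) hm (by simpa using h2)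
      push_cast
      gcongr

lemma hittingTime_eq_one (h : T x ∈ A) : hittingTime T A x = 1 := by
  have : hittingTime T A x = ((1 : ℕ) : ℕ∞) :=
    hittingTime_eq_natCast_iff.2 ⟨le_rfl, by simpa using h, fun m h1 h2 => by omega⟩
  simpa using this

open Classical in
/-- The hitting time of `A ⊆ Y` under the first-return map of `Y` counts the visits to `Y`
up to the hitting time of `A`. -/
theorem inducedHittingTime_eq_card (hAY : A ⊆ Y) {n : ℕ} (hn : hittingTime T A x = n) :
    inducedHittingTime T Y A x = ((Finset.range n).filter fun i => T^[i + 1] x ∈ Y).card := by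
  induction n using Nat.strong_induction_on generalizing x with
  | _ n ih =>
    obtain ⟨h1, h2, h3⟩ := hittingTime_eq_natCast_iff.1 hn
    -- `m` is the first visit to `Y`, not later than `n` because `A ⊆ Y`. The times `1, …, m`
    -- contribute one visit, and the induction restarts at `T^[m] x`.
    obtain ⟨m, hm⟩ := ENat.ne_top_iff_exists.1
      (hittingTime_ne_top_iff.2 ⟨n, h1, hAY h2⟩ : hittingTime T Y x ≠ ⊤)
    obtain ⟨hm1, hmY, hm3⟩ := hittingTime_eq_natCast_iff.1 hm.symm
    have hmn : m ≤ n := by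
      by_contra! hlt
      exact hm3 n h1 hlt (hAY h2)
    have hind : inducedMap T Y x = T^[m] x := by simp [inducedMap, ← hm]
    have hcount : ((Finset.range m).filter fun i => T^[i + 1] x ∈ Y) = {m - 1} := by
      ext i
      simp only [Finset.mem_filter, Finset.mem_range, Finset.mem_singleton]
      constructor
      · rintro ⟨hi, hiY⟩
        by_contra hne
        exact hm3 (i + 1) (by omega) (by omega) hiY
      · rintro rfl
        refine ⟨by omega, ?_⟩
        rwa [Nat.sub_add_cancel hm1]
    rcases hmn.eq_or_lt with rfl | hlt
    · rw [hcount, inducedHittingTime, hittingTime_eq_one (by rw [hind]; exact h2)]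
      simp
    · have hnot : T^[m] x ∉ A := h3 m hm1 hlt
      have hrest : hittingTime T A (T^[m] x) = ((n - m : ℕ) : ℕ∞) := by
        refine hittingTime_eq_natCast_iff.2 ⟨by omega, ?_, fun k hk hkn => ?_⟩
        · rwa [← Function.iterate_add_apply, Nat.sub_add_cancel hmn]
        · rw [← Function.iterate_add_apply]
          exact h3 (k + m) (by omega) (by omega)
      have hrec := ih (n - m) (by omega) hrest
      rw [inducedHittingTime, hittingTime_eq_comp_add_one (by rwa [hind]), hind]
      rw [inducedHittingTime] at hrec
      rw [hrec]
      have hsplit : ((Finset.range n).filter fun i => T^[i + 1] x ∈ Y).card =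
          ((Finset.range m).filter fun i => T^[i + 1] x ∈ Y).card +
          ((Finset.range (n - m)).filter fun i => T^[i + 1] (T^[m] x) ∈ Y).card := by
        simp only [Finset.card_filter]
        conv_lhs => rw [← Nat.add_sub_cancel' hmn, Finset.sum_range_add]
        congr 1
        refine Finset.sum_congr rfl fun i _ => ?_
        rw [← Function.iterate_add_apply, show i + 1 + m = m + i + 1 by omega]
      rw [hsplit, hcount]
      push_cast
      simp [add_comm]

variable [MeasurableSpace X]

lemma measurable_hittingTime (hT : Measurable T) (hA : MeasurableSet A) :
    Measurable (hittingTime T A) := by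
  refine ENat.measurable_iff.2 fun n => ?_
  have : hittingTime T A ⁻¹' {(n : ℕ∞)} = {x | 1 ≤ n ∧ T^[n] x ∈ A ∧
      ∀ m, 1 ≤ m → m < n → T^[m] x ∉ A} := by
    ext x
    exact hittingTime_eq_natCast_iff
  rw [this]
  have hm : ∀ m, MeasurableSet {x | T^[m] x ∈ A} := fun m => hT.iterate m hA
  have hall : MeasurableSet {x | ∀ m, 1 ≤ m → m < n → T^[m] x ∉ A} := by
    simp only [Set.ofPred_forall]
    exact MeasurableSet.iInter fun m => MeasurableSet.iInter fun _ => MeasurableSet.iInter fun _ =>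
      (hm m).compl
  exact (MeasurableSet.const _).inter ((hm n).inter hall)

lemma measurable_inducedMap (hT : Measurable T) (hY : MeasurableSet Y) :
    Measurable (inducedMap T Y) := by
  have hF : Measurable fun p : X × ℕ => T^[p.2] p.1 :=
    measurable_from_prod_countable_left fun n => hT.iterate n
  have hg : Measurable fun x => (hittingTime T Y x).toNat :=
    (measurable_of_countable ENat.toNat).comp (measurable_hittingTime hT hY)
  exact hF.comp (measurable_id.prodMk hg)

lemma measurable_inducedHittingTime (hT : Measurable T) (hY : MeasurableSet Y)
    (hA : MeasurableSet A) : Measurable (inducedHittingTime T Y A) :=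
  measurable_hittingTime (measurable_inducedMap hT hY) hA

variable {μ : Measure X}

lemma measure_hittingTime_le (hT : MeasurePreserving T μ μ) (hA : MeasurableSet A) (n : ℕ) :
    μ {x | hittingTime T A x ≤ n} ≤ n * μ A := by
  have hsub : {x | hittingTime T A x ≤ n} ⊆ ⋃ i ∈ Finset.range n, T^[i + 1] ⁻¹' A := by
    intro x hx
    obtain ⟨m, h1, h2, h3⟩ := hittingTime_le_natCast_iff.1 hx
    simp only [Set.mem_iUnion, Finset.mem_range]
    refine ⟨m - 1, by omega, ?_⟩
    rw [Nat.sub_add_cancel h1]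
    exact h3
  refine (measure_mono hsub).trans ((measure_biUnion_finset_le _ _).trans ?_)
  simp_rw [(hT.iterate _).measure_preimage hA.nullMeasurableSet]
  simp

/-- The points of `A` that do not return to `A` within `n` steps have measure at most
`1 / (n + 1)`. -/
lemma measure_inter_lt_hittingTime_le [IsProbabilityMeasure μ] (hT : MeasurePreserving T μ μ)
    (hA : MeasurableSet A) (n : ℕ) :
    ((n + 1 : ℕ) : ℝ≥0∞) * μ (A ∩ {x | (n : ℕ∞) < hittingTime T A x}) ≤ 1 := by
  set B := A ∩ {x | (n : ℕ∞) < hittingTime T A x}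
  have hB : MeasurableSet B :=
    hA.inter (measurable_hittingTime hT.measurable hA (DiscreteMeasurableSpace.forall_measurableSet (Set.Ioi (n : ℕ∞))))
  -- A common point of the preimages for `i < j` would give a point of `B` that returns to `A` after
  -- `j - i ≤ n` steps.
  have hdisj : Set.PairwiseDisjoint (↑(Finset.range (n + 1))) fun i => T^[i] ⁻¹' B := by
    have key : ∀ i j, i < j → j < n + 1 → Disjoint (T^[i] ⁻¹' B) (T^[j] ⁻¹' B) := by
      intro i j hij hj
      rw [Set.disjoint_left]
      intro x hi hjx
      refine absurd hi.2 (not_lt.2 (hittingTime_le_natCast_iff.2 ⟨j - i, by omega, by omega, ?_⟩))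
      rw [← Function.iterate_add_apply, Nat.sub_add_cancel hij.le]
      exact hjx.1
    intro i hi j hj hij
    simp only [Finset.coe_range, Set.mem_Iio] at hi hj
    rcases lt_or_gt_of_ne hij with h | h
    · exact key i j h hj
    · exact (key j i h hi).symm
  calc ((n + 1 : ℕ) : ℝ≥0∞) * μ B = ∑ i ∈ Finset.range (n + 1), μ (T^[i] ⁻¹' B) := by
        simp_rw [(hT.iterate _).measure_preimage hB.nullMeasurableSet]
        simp
    _ = μ (⋃ i ∈ Finset.range (n + 1), T^[i] ⁻¹' B) :=
        (measure_biUnion_finset hdisj fun i _ => hT.measurable.iterate i hB).symm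
    _ ≤ 1 := prob_le_one

/-- Almost every point hits a set of positive measure. -/
lemma ae_hittingTime_ne_top [IsFiniteMeasure μ] (hT : Ergodic T μ) (hA : MeasurableSet A)
    (hpos : μ A ≠ 0) : ∀ᵐ x ∂μ, hittingTime T A x ≠ ⊤ := by
  have hmeas : MeasurableSet {x | hittingTime T A x ≠ ⊤} :=
    measurable_hittingTime hT.measurable hA (measurableSet_singleton (⊤ : ℕ∞)).compl
  have hsub : T ⁻¹' {x | hittingTime T A x ≠ ⊤} ⊆ {x | hittingTime T A x ≠ ⊤} := by
    intro x hx
    obtain ⟨n, h1, h2⟩ := hittingTime_ne_top_iff.1 hx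
    exact hittingTime_ne_top_iff.2 ⟨n + 1, by omega, by simpa using h2⟩
  -- The set of points that hit `A` contains its own preimage, so it is null or full; it also
  -- contains `T ⁻¹' A`, of measure `μ A ≠ 0`.
  rcases hT.ae_empty_or_univ_of_preimage_ae_le hmeas.nullMeasurableSet
    (LE.le.eventuallyLE hsub) with h | h
  · exfalso
    have h1 : T ⁻¹' A ⊆ {x | hittingTime T A x ≠ ⊤} := fun x hx =>
      hittingTime_ne_top_iff.2 ⟨1, le_rfl, by simpa using hx⟩
    have h2 := measure_mono_null h1 (ae_eq_empty.1 h)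
    rw [hT.toMeasurePreserving.measure_preimage hA.nullMeasurableSet] at h2
    exact hpos h2
  · exact eventuallyEq_univ.1 h

end HittingTime

/-! ### A compatible metric on `[0, ∞]` -/

section Compactify

/-- The homeomorphism `x ↦ 1 / (1 + x)` of `[0, ∞]` onto `[0, 1]`, as a real-valued function. -/
noncomputable def compactify (x : ℝ≥0∞) : ℝ := ((1 + x)⁻¹).toReal

lemma one_add_inv_ne_top (x : ℝ≥0∞) : (1 + x)⁻¹ ≠ ∞ := by simp

lemma continuous_compactify : Continuous compactify :=
  ENNReal.continuousOn_toReal.comp_continuous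
    (continuous_inv.comp (continuous_const_add 1)) one_add_inv_ne_top

lemma compactify_nonneg (x : ℝ≥0∞) : 0 ≤ compactify x := ENNReal.toReal_nonneg

lemma compactify_le_one (x : ℝ≥0∞) : compactify x ≤ 1 := by
  have : (1 + x)⁻¹ ≤ 1 := ENNReal.inv_le_one.2 le_self_add
  simpa [compactify] using ENNReal.toReal_mono ENNReal.one_ne_top this

lemma abs_compactify_sub_le_one (x y : ℝ≥0∞) : |compactify x - compactify y| ≤ 1 :=
  abs_sub_le_iff.2 ⟨by linarith [compactify_le_one x, compactify_nonneg y],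
    by linarith [compactify_le_one y, compactify_nonneg x]⟩

/-- A continuous left inverse of `compactify`. -/
noncomputable def uncompactify (r : ℝ) : ℝ≥0∞ := (ENNReal.ofReal r)⁻¹ - 1

lemma continuous_uncompactify : Continuous uncompactify :=
  (ENNReal.continuous_sub_right 1).comp (continuous_inv.comp ENNReal.continuous_ofReal)

lemma uncompactify_compactify (x : ℝ≥0∞) : uncompactify (compactify x) = x := by
  rw [uncompactify, compactify, ENNReal.ofReal_toReal (one_add_inv_ne_top x), inv_inv]
  exact ENNReal.add_sub_cancel_left ENNReal.one_ne_top

lemma compactify_ofReal {t : ℝ} (ht : 0 ≤ t) : compactify (ENNReal.ofReal t) = (1 + t)⁻¹ := by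
  rw [compactify, ENNReal.toReal_inv, ENNReal.toReal_add (by simp) (by simp),
    ENNReal.toReal_ofReal ht, ENNReal.toReal_one]

lemma abs_compactify_sub_le {s t : ℝ} (hs : 0 ≤ s) (ht : 0 ≤ t) :
    |compactify (ENNReal.ofReal s) - compactify (ENNReal.ofReal t)| ≤ |s - t| := by
  rw [compactify_ofReal hs, compactify_ofReal ht, inv_sub_inv (by positivity) (by positivity),
    abs_div, abs_of_pos (show 0 < (1 + s) * (1 + t) by positivity)]
  rw [show 1 + t - (1 + s) = -(s - t) by ring, abs_neg]
  exact div_le_self (abs_nonneg _) (by nlinarith [mul_nonneg hs ht])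

/-- The bound is uniform in `t`: a relative error matters no more than its size, however large the
value. No tightness of the hitting times is therefore needed. -/
lemma abs_compactify_mul_sub_le {r t : ℝ} (hr : 0 ≤ r) (ht : 0 ≤ t) :
    |compactify (ENNReal.ofReal (t * r)) - compactify (ENNReal.ofReal t)| ≤ |r - 1| := by
  have htr := mul_nonneg ht hr
  rw [compactify_ofReal htr, compactify_ofReal ht,
    inv_sub_inv (by positivity) (by positivity), abs_div,
    abs_of_pos (show 0 < (1 + t * r) * (1 + t) by positivity), div_le_iff₀ (by positivity),
    show 1 + t - (1 + t * r) = -(t * (r - 1)) by ring, abs_neg, abs_mul, abs_of_nonneg ht,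
    mul_comm]
  have h1 : t ≤ (1 + t * r) * (1 + t) := by nlinarith [mul_nonneg htr ht]
  gcongr

end Compactify

/-! ### Convergence in law of `[0, ∞]`-valued variables -/

section Distribution

variable {Ω Ω' : Type*} [MeasurableSpace Ω] [MeasurableSpace Ω']
  {P : Measure Ω'} [IsProbabilityMeasure P] {R : Ω' → ℝ≥0∞}

/-- Continuous mapping in both directions reduces to real variables, for which differences make
sense. -/
lemma tendstoInDistribution_iff_compactify {ν : Measure Ω} [IsProbabilityMeasure ν]
    {X : ℕ → Ω → ℝ≥0∞} :
    TendstoInDistribution X atTop R (fun _ => ν) P ↔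
      TendstoInDistribution (fun k => compactify ∘ X k) atTop (compactify ∘ R) (fun _ => ν) P := by
  refine ⟨fun h => h.continuous_comp continuous_compactify, fun h => ?_⟩
  have := h.continuous_comp continuous_uncompactify
  simpa only [← Function.comp_assoc, show uncompactify ∘ compactify = id from
    funext uncompactify_compactify, Function.id_comp] using this

/-- Sequences of `[0, ∞]`-valued random variables that are asymptotically equal in probability,
in a metric compatible with the topology, have the same limits in distribution. -/
lemma tendstoInDistribution_congr_of_tendstoInMeasure {ν : Measure Ω} [IsProbabilityMeasure ν]
    {X Z : ℕ → Ω → ℝ≥0∞} (hX : ∀ k, AEMeasurable (X k) ν) (hZ : ∀ k, AEMeasurable (Z k) ν)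
    (h : ∀ ε : ℝ, 0 < ε →
      Tendsto (fun k => ν {ω | ε ≤ |compactify (X k ω) - compactify (Z k ω)|}) atTop (𝓝 0)) :
    TendstoInDistribution X atTop R (fun _ => ν) P ↔
      TendstoInDistribution Z atTop R (fun _ => ν) P := by
  rw [tendstoInDistribution_iff_compactify, tendstoInDistribution_iff_compactify (X := Z)]
  have h1 : TendstoInMeasure ν ((fun k => compactify ∘ X k) - fun k => compactify ∘ Z k)
      atTop 0 := by
    rw [tendstoInMeasure_iff_norm]
    simpa using h
  have h2 : TendstoInMeasure ν ((fun k => compactify ∘ Z k) - fun k => compactify ∘ X k)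
      atTop 0 := by
    rw [tendstoInMeasure_iff_norm]
    simpa [abs_sub_comm] using h
  exact ⟨fun hd => tendstoInDistribution_of_tendstoInMeasure_sub _ _ hd h2
      fun k => continuous_compactify.measurable.comp_aemeasurable (hZ k),
    fun hd => tendstoInDistribution_of_tendstoInMeasure_sub _ _ hd h1
      fun k => continuous_compactify.measurable.comp_aemeasurable (hX k)⟩

/-- If the integrals of Lipschitz functions of `X k` with respect to `ν` and `ν'` are
asymptotically equal, then `X k` has the same limits in distribution under `ν` and `ν'`. -/
lemma TendstoInDistribution.of_lipschitz_integral_sub {ν ν' : Measure Ω} [IsProbabilityMeasure ν]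
    [IsProbabilityMeasure ν'] {X : ℕ → Ω → ℝ} {Z : Ω' → ℝ} (hX : ∀ k, AEMeasurable (X k) ν')
    (h : ∀ g : ℝ → ℝ, (∃ C, ∀ x, |g x| ≤ C) → (∃ L, LipschitzWith L g) →
      Tendsto (fun k => ∫ ω, g (X k ω) ∂ν' - ∫ ω, g (X k ω) ∂ν) atTop (𝓝 0))
    (hd : TendstoInDistribution X atTop Z (fun _ => ν) P) :
    TendstoInDistribution X atTop Z (fun _ => ν') P where
  forall_aemeasurable := hX
  aemeasurable_limit := hd.aemeasurable_limit
  tendsto := by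
    have hXν := hd.forall_aemeasurable
    have ht := tendsto_iff_forall_lipschitz_integral_tendsto.1 hd.tendsto
    refine tendsto_iff_forall_lipschitz_integral_tendsto.2 fun g hb hL => ?_
    obtain ⟨L, hL⟩ := hL
    have h1 := ht g hb ⟨L, hL⟩
    obtain ⟨C, hC⟩ := hb
    -- Here `C` bounds the oscillation of `g`, so `|g|` is bounded by `|g 0| + C`.
    have h2 := h g ⟨dist (g 0) 0 + C, fun x => by
      have a := dist_triangle (g x) (g 0) 0
      have b := hC x 0
      rw [Real.dist_0_eq_abs] at a
      linarith⟩ ⟨L, hL⟩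
    have h3 := h2.add h1
    simp only [ProbabilityMeasure.coe_mk, zero_add] at h3 ⊢
    refine h3.congr fun k => ?_
    rw [integral_map (hXν k) hL.continuous.aestronglyMeasurable,
      integral_map (hX k) hL.continuous.aestronglyMeasurable]
    ring

end Distribution

/-! ### Changing the initial measure -/

section Transfer

variable {X : Type*} [MeasurableSpace X] {μ : Measure X} {T : X → X}

lemma tendsto_integral_abs_birkhoffAverage [IsProbabilityMeasure μ] (hT : Ergodic T μ)
    {u : X → ℝ} (hu : Measurable u) {C : ℝ} (hC : ∀ x, |u x| ≤ C) (h0 : ∫ x, u x ∂μ = 0) :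
    Tendsto (fun n => ∫ x, |birkhoffAverage ℝ T u n x| ∂μ) atTop (𝓝 0) := by
  have hC0 : 0 ≤ C := by
    obtain ⟨x⟩ : Nonempty X := nonempty_of_isProbabilityMeasure μ
    exact (abs_nonneg _).trans (hC x)
  have hint : Integrable u μ := .of_bound hu.aestronglyMeasurable C (.of_forall hC)
  have hm : ∀ n, Measurable (birkhoffAverage ℝ T u n) := fun n => by
    exact (Finset.measurable_sum _ fun i _ => hu.comp (hT.measurable.iterate i)).const_smul (n : ℝ)⁻¹
  have hlim := ae_tendsto_birkhoffAverage hT hu hint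
  have : Tendsto (fun n => ∫ x, |birkhoffAverage ℝ T u n x| ∂μ) atTop (𝓝 (∫ _, (0 : ℝ) ∂μ)) := by
    refine tendsto_integral_of_dominated_convergence (fun _ => C)
      (fun n => (hm n).abs.aestronglyMeasurable) (integrable_const C) ?_ ?_
    · intro n
      refine .of_forall fun x => ?_
      rw [Real.norm_eq_abs, abs_abs, birkhoffAverage, smul_eq_mul, abs_mul, abs_inv, Nat.abs_cast]
      rcases n.eq_zero_or_pos with rfl | hn
      · simpa using hC0
      · have hn' : (0 : ℝ) < n := by exact_mod_cast hn
        rw [inv_mul_le_iff₀ hn']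
        refine (Finset.abs_sum_le_sum_abs _ _).trans ((Finset.sum_le_card_nsmul _ _ C
          fun i _ => hC _).trans ?_)
        simp
    · filter_upwards [hlim] with x hx
      rw [h0] at hx
      simpa using hx.abs
  simpa using this

/-- Bounded functions that are asymptotically `T`-invariant in mean are asymptotically orthogonal
to every bounded function of mean zero. -/
lemma tendsto_integral_mul_of_asymp_invariant [IsProbabilityMeasure μ] (hT : Ergodic T μ)
    {u : X → ℝ} (hu : Measurable u) {C : ℝ} (hC : ∀ x, |u x| ≤ C) (h0 : ∫ x, u x ∂μ = 0)
    {G : ℕ → X → ℝ} (hG : ∀ k, Measurable (G k)) {D : ℝ} (hD : ∀ k x, |G k x| ≤ D)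
    (hinv : Tendsto (fun k => ∫ x, |G k (T x) - G k x| ∂μ) atTop (𝓝 0)) :
    Tendsto (fun k => ∫ x, u x * G k x ∂μ) atTop (𝓝 0) := by
  have hui : ∀ j, Measurable fun x => u (T^[j] x) := fun j => hu.comp (hT.measurable.iterate j)
  have hGT : ∀ k, Measurable fun x => G k (T x) := fun k => (hG k).comp hT.measurable
  have hC0 : 0 ≤ C := by
    obtain ⟨x⟩ : Nonempty X := nonempty_of_isProbabilityMeasure μ
    exact (abs_nonneg _).trans (hC x)
  have hD0 : 0 ≤ D := by
    obtain ⟨x⟩ : Nonempty X := nonempty_of_isProbabilityMeasure μ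
    exact (abs_nonneg _).trans (hD 0 x)
  have hbd : ∀ {v w : X → ℝ} {c d : ℝ}, Measurable v → Measurable w → (∀ x, |v x| ≤ c) →
      (∀ x, |w x| ≤ d) → 0 ≤ c → Integrable (fun x => v x * w x) μ := by
    intro v w c d hv hw hc hd hc0
    refine .of_bound (hv.mul hw).aestronglyMeasurable (c * d) (.of_forall fun x => ?_)
    rw [Real.norm_eq_abs, abs_mul]
    exact mul_le_mul (hc x) (hd x) (abs_nonneg _) hc0
  have hI : ∀ k j, Integrable (fun x => u (T^[j] x) * G k x) μ := fun k j =>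
    hbd (hui j) (hG k) (fun x => hC _) (hD k) hC0
  have hIT : ∀ k j, Integrable (fun x => u (T^[j] x) * G k (T x)) μ := fun k j =>
    hbd (hui j) (hGT k) (fun x => hC _) (fun x => hD k _) hC0
  have hinvI : ∀ k, Integrable (fun x => |G k (T x) - G k x|) μ := fun k =>
    .of_bound ((hGT k).sub (hG k)).abs.aestronglyMeasurable (D + D) (.of_forall fun x => by
      rw [Real.norm_eq_abs, abs_abs]
      exact (abs_sub _ _).trans (add_le_add (hD _ _) (hD _ _)))
  -- Invariance of `μ` turns the first integral into that of `u ∘ T^[j + 1]` times `G k ∘ T`; the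
  -- difference is then at most `C` times the mean of `|G k ∘ T - G k|`.
  have hstep : ∀ j, Tendsto (fun k => ∫ x, u (T^[j] x) * G k x ∂μ -
      ∫ x, u (T^[j + 1] x) * G k x ∂μ) atTop (𝓝 0) := by
    intro j
    refine squeeze_zero_norm (fun k => ?_) (by simpa using hinv.const_mul C)
    have h1 : ∫ x, u (T^[j] x) * G k x ∂μ = ∫ x, u (T^[j + 1] x) * G k (T x) ∂μ := by
      conv_lhs => rw [← hT.map_eq]
      rw [integral_map hT.measurable.aemeasurable
        (by rw [hT.map_eq]; exact (hI k j).aestronglyMeasurable)]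
      rfl
    rw [h1, ← integral_sub (hIT k _) (hI k _), Real.norm_eq_abs, ← integral_const_mul]
    refine (abs_integral_le_integral_abs).trans (integral_mono ((hIT k _).sub (hI k _)).abs
      ((hinvI k).const_mul C) fun x => ?_)
    simp only [← mul_sub, abs_mul]
    exact mul_le_mul_of_nonneg_right (hC _) (abs_nonneg _)
  have hiter : ∀ j, Tendsto (fun k => ∫ x, u x * G k x ∂μ - ∫ x, u (T^[j] x) * G k x ∂μ)
      atTop (𝓝 0) := by
    intro j
    induction j with
    | zero => simp
    | succ j ih => simpa using ih.add (hstep j)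
  have havg : ∀ n : ℕ, n ≠ 0 → Tendsto (fun k => ∫ x, u x * G k x ∂μ -
      ∫ x, birkhoffAverage ℝ T u n x * G k x ∂μ) atTop (𝓝 0) := by
    intro n hn
    have h1 := (tendsto_finsetSum (Finset.range n) fun j _ => hiter j).const_mul ((n : ℝ)⁻¹)
    simp only [Finset.sum_const_zero, mul_zero] at h1
    refine h1.congr fun k => ?_
    have h2 : ∫ x, birkhoffAverage ℝ T u n x * G k x ∂μ =
        (n : ℝ)⁻¹ * ∑ j ∈ Finset.range n, ∫ x, u (T^[j] x) * G k x ∂μ := by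
      rw [← integral_finsetSum _ fun j _ => hI k j, ← integral_const_mul]
      refine integral_congr_ae (.of_forall fun x => ?_)
      simp [birkhoffAverage, birkhoffSum, Finset.sum_mul, mul_assoc]
    rw [h2, Finset.sum_sub_distrib, Finset.sum_const, Finset.card_range, nsmul_eq_mul, mul_sub,
      inv_mul_cancel_left₀ (by exact_mod_cast hn)]
  rw [Metric.tendsto_atTop']
  intro ε hε
  -- Order of choices: `n` makes the averaged `u` small in mean, uniformly against all `G k`; only
  -- then is `k` taken large for this fixed `n`.
  have hA := (tendsto_integral_abs_birkhoffAverage hT hu hC h0).const_mul D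
  rw [mul_zero] at hA
  obtain ⟨n, hn, hn0⟩ := ((hA.eventually_lt_const (half_pos hε)).and
    (eventually_ne_atTop 0)).exists
  obtain ⟨K, hK⟩ := Metric.tendsto_atTop'.1 (havg n hn0) (ε / 2) (half_pos hε)
  refine ⟨K, fun k hk => ?_⟩
  have h1 := hK k hk
  have hAm : Measurable (birkhoffAverage ℝ T u n) := by
    exact (Finset.measurable_sum _ fun i _ => hui i).const_smul (n : ℝ)⁻¹
  have hAi : Integrable (birkhoffAverage ℝ T u n) μ := by
    exact (integrable_finsetSum _ fun i _ => Integrable.of_bound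
      (hui i).aestronglyMeasurable C (.of_forall fun x => hC _)).smul (n : ℝ)⁻¹
  have hAG : Integrable (fun x => birkhoffAverage ℝ T u n x * G k x) μ :=
    hAi.mul_bdd (c := D) (hG k).aestronglyMeasurable (.of_forall fun x => hD k x)
  have h2 : |∫ x, birkhoffAverage ℝ T u n x * G k x ∂μ| ≤
      D * ∫ x, |birkhoffAverage ℝ T u n x| ∂μ := by
    rw [← integral_const_mul]
    refine (abs_integral_le_integral_abs).trans (integral_mono hAG.abs (hAi.abs.const_mul D)
      fun x => ?_)
    simp only [abs_mul]
    rw [mul_comm]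
    exact mul_le_mul_of_nonneg_right (hD _ _) (abs_nonneg _)
  rw [Real.dist_0_eq_abs] at h1 ⊢
  have h3 := abs_add_le (∫ x, u x * G k x ∂μ - ∫ x, birkhoffAverage ℝ T u n x * G k x ∂μ)
    (∫ x, birkhoffAverage ℝ T u n x * G k x ∂μ)
  rw [sub_add_cancel] at h3
  linarith

/-- Functions bounded by `1` that tend to `0` in probability tend to `0` in mean. -/
lemma tendsto_integral_abs_of_tendsto_measure [IsProbabilityMeasure μ] {F : ℕ → X → ℝ}
    (hF : ∀ k, Measurable (F k)) (hb : ∀ k x, |F k x| ≤ 1)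
    (h : ∀ ε : ℝ, 0 < ε → Tendsto (fun k => μ {x | ε ≤ |F k x|}) atTop (𝓝 0)) :
    Tendsto (fun k => ∫ x, |F k x| ∂μ) atTop (𝓝 0) := by
  have hbound : ∀ ε : ℝ, 0 < ε → ∀ k, ∫ x, |F k x| ∂μ ≤ ε + (μ {x | ε ≤ |F k x|}).toReal := by
    intro ε hε k
    have hms : MeasurableSet {x | ε ≤ |F k x|} := measurableSet_le measurable_const (hF k).abs
    have h1 : (μ {x | ε ≤ |F k x|}).toReal =
        ∫ x, Set.indicator {x | ε ≤ |F k x|} (fun _ => (1 : ℝ)) x ∂μ := by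
      rw [integral_indicator_const _ hms]
      simp [Measure.real]
    have h2 : ∫ x, (ε + Set.indicator {x | ε ≤ |F k x|} (fun _ => (1 : ℝ)) x) ∂μ =
        ε + (μ {x | ε ≤ |F k x|}).toReal := by
      rw [integral_add (integrable_const ε) ((integrable_const _).indicator hms), h1]
      simp
    rw [← h2]
    refine integral_mono (Integrable.of_bound (hF k).abs.aestronglyMeasurable 1
      (.of_forall fun x => by simpa using hb k x))
      ((integrable_const ε).add ((integrable_const _).indicator hms)) fun x => ?_
    by_cases hx : ε ≤ |F k x|
    · simp only [Set.indicator, Set.mem_ofPred_eq, hx, if_true]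
      linarith [hb k x]
    · simp only [Set.indicator, Set.mem_ofPred_eq, hx, if_false]
      linarith
  rw [Metric.tendsto_atTop']
  intro ε hε
  have ht := (ENNReal.tendsto_toReal ENNReal.zero_ne_top).comp (h (ε / 2) (half_pos hε))
  obtain ⟨K, hK⟩ := eventually_atTop.1 (ht.eventually_lt_const (u := ε / 2) (by simpa using hε))
  refine ⟨K, fun k hk => ?_⟩
  have h1 := hK k hk.le
  have h2 := hbound (ε / 2) (half_pos hε) k
  rw [Real.dist_0_eq_abs, abs_of_nonneg (integral_nonneg fun x => abs_nonneg _)]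
  simp only [Function.comp_apply] at h1
  linarith

/-- If `Z k ∘ T` and `Z k` are asymptotically equal in probability, then `Z k` has the same limits
in distribution under `μ` and under `μ` conditioned on a set of positive measure. -/
theorem tendstoInDistribution_cond_iff [IsProbabilityMeasure μ] (hT : Ergodic T μ)
    {Y : Set X} (hYm : MeasurableSet Y) (hY : μ Y ≠ 0) [IsProbabilityMeasure μ[|Y]]
    {Z : ℕ → X → ℝ≥0∞} (hZ : ∀ k, Measurable (Z k))
    (hinv : ∀ ε : ℝ, 0 < ε →
      Tendsto (fun k => μ {x | ε ≤ |compactify (Z k (T x)) - compactify (Z k x)|}) atTop (𝓝 0))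
    {Ω : Type*} [MeasurableSpace Ω] {P : Measure Ω} [IsProbabilityMeasure P] {R : Ω → ℝ≥0∞} :
    TendstoInDistribution Z atTop R (fun _ => μ[|Y]) P ↔
      TendstoInDistribution Z atTop R (fun _ => μ) P := by
  rw [tendstoInDistribution_iff_compactify, tendstoInDistribution_iff_compactify (ν := μ)]
  have hm : ∀ k, Measurable (compactify ∘ Z k) := fun k =>
    continuous_compactify.measurable.comp (hZ k)
  have hmean := tendsto_integral_abs_of_tendsto_measure
    (F := fun k x => compactify (Z k (T x)) - compactify (Z k x))
    (fun k => ((hm k).comp hT.measurable).sub (hm k))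
    (fun k x => abs_compactify_sub_le_one _ _) hinv
  have hYr : 0 < (μ Y).toReal := ENNReal.toReal_pos hY (measure_ne_top μ Y)
  have key : ∀ g : ℝ → ℝ, (∃ C, ∀ x, |g x| ≤ C) → (∃ L, LipschitzWith L g) →
      Tendsto (fun k => ∫ ω, g ((compactify ∘ Z k) ω) ∂μ[|Y] -
        ∫ ω, g ((compactify ∘ Z k) ω) ∂μ) atTop (𝓝 0) := by
    rintro g ⟨C, hC⟩ ⟨L, hL⟩
    have hgm : ∀ k, Measurable fun x => g ((compactify ∘ Z k) x) := fun k =>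
      hL.continuous.measurable.comp (hm k)
    have hgi : ∀ k, Integrable (fun x => g ((compactify ∘ Z k) x)) μ := fun k =>
      .of_bound (hgm k).aestronglyMeasurable C (.of_forall fun x => hC _)
    have huI : Integrable (fun x => Y.indicator (fun _ => (μ Y).toReal⁻¹) x) μ :=
      (integrable_const _).indicator hYm
    have hginv : Tendsto (fun k => ∫ x, |g (compactify (Z k (T x))) - g (compactify (Z k x))| ∂μ)
        atTop (𝓝 0) := by
      refine squeeze_zero (fun k => integral_nonneg fun x => abs_nonneg _) (fun k => ?_)
        (by simpa using hmean.const_mul (L : ℝ))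
      rw [← integral_const_mul]
      refine integral_mono
        ((hT.toMeasurePreserving.integrable_comp_of_integrable (hgi k)).sub (hgi k)).abs
        ((Integrable.of_bound
          (((hm k).comp hT.measurable).sub (hm k)).abs.aestronglyMeasurable 1
          (.of_forall fun x => ?_)).const_mul _) fun x => hL.dist_le_mul _ _
      refine (abs_abs _).trans_le ?_
      exact abs_compactify_sub_le_one _ _
    -- `u` is the density of `μ[|Y]` with respect to `μ`, minus `1`; it has mean zero, and pairing
    -- with it gives the difference of the two integrals.
    have hlim := tendsto_integral_mul_of_asymp_invariant hT
      (u := fun x => Y.indicator (fun _ => (μ Y).toReal⁻¹) x - 1)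
      ((measurable_const.indicator hYm).sub_const 1) (C := (μ Y).toReal⁻¹ + 1)
      (fun x => (abs_sub _ _).trans (by
        rw [abs_one]
        gcongr
        by_cases hx : x ∈ Y
        · simp [hx]
        · simp [hx])) (by
        rw [integral_sub huI (integrable_const 1), integral_indicator_const _ hYm]
        simp [Measure.real, hYr.ne'])
      (G := fun k x => g ((compactify ∘ Z k) x)) hgm (D := C) (fun k x => hC _)
      hginv
    refine hlim.congr fun k => ?_
    have h1 : ∫ x, g ((compactify ∘ Z k) x) ∂μ[|Y] =
        ∫ x, Y.indicator (fun _ => (μ Y).toReal⁻¹) x * g ((compactify ∘ Z k) x) ∂μ := by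
      rw [ProbabilityTheory.cond, integral_smul_measure, ← integral_indicator hYm, smul_eq_mul,
        ← integral_const_mul, ENNReal.toReal_inv]
      refine integral_congr_ae (.of_forall fun x => ?_)
      by_cases hx : x ∈ Y <;> simp [hx]
    rw [h1, ← integral_sub _ (hgi k)]
    · simp only [sub_mul, one_mul]
    · exact (hgi k).bdd_mul (measurable_const.indicator hYm).aestronglyMeasurable (c := (μ Y).toReal⁻¹)
        (.of_forall fun x => by by_cases hx : x ∈ Y <;> simp [hx])
  constructor
  · refine TendstoInDistribution.of_lipschitz_integral_sub (fun k => (hm k).aemeasurable) ?_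
    intro g hg hL
    simpa using (key g hg hL).neg
  · exact TendstoInDistribution.of_lipschitz_integral_sub (fun k => (hm k).aemeasurable) key

end Transfer

/-! ### Rarity, closeness and comparison of the hitting times -/

section Main

variable {X : Type*} [MeasurableSpace X] {μ : Measure X} {T : X → X} {Y : Set X}

lemma mul_coe_eq_ofReal {c : ℝ≥0∞} (hc : c ≠ ∞) {φ : ℕ∞} (hφ : φ ≠ ⊤) :
    c * (φ : ℝ≥0∞) = ENNReal.ofReal (c.toReal * (φ.toNat : ℝ)) := by
  obtain ⟨n, rfl⟩ := ENat.ne_top_iff_exists.1 hφ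
  rw [ENNReal.ofReal_mul ENNReal.toReal_nonneg, ENNReal.ofReal_toReal hc]
  simp

lemma measurable_mul_coe {c : ℝ≥0∞} {φ : X → ℕ∞} (hφ : Measurable φ) :
    Measurable fun x => c * (φ x : ℝ≥0∞) :=
  ((measurable_of_countable fun n : ℕ∞ => (n : ℝ≥0∞)).comp hφ).const_mul c

lemma cond_le_inv_mul (hYm : MeasurableSet Y) (s : Set X) : μ[|Y] s ≤ (μ Y)⁻¹ * μ s := by
  rw [cond_apply hYm]
  gcongr
  exact Set.inter_subset_right

lemma tendsto_cond_zero [IsProbabilityMeasure μ] (hYm : MeasurableSet Y) (hY : μ Y ≠ 0)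
    {s : ℕ → Set X} (hs : Tendsto (fun k => μ (s k)) atTop (𝓝 0)) :
    Tendsto (fun k => μ[|Y] (s k)) atTop (𝓝 0) := by
  have h := ENNReal.Tendsto.const_mul (a := (μ Y)⁻¹) hs (.inr (by simpa using hY))
  rw [mul_zero] at h
  exact tendsto_of_tendsto_of_tendsto_of_le_of_le tendsto_const_nhds h (fun _ => zero_le)
    fun k => cond_le_inv_mul hYm _

lemma hittingTimesClose_iff {E E' : ℕ → Set X} :
    HittingTimesClose μ T Y E E' ↔ ∀ ε : ℝ, 0 < ε → Tendsto (fun k => μ[|Y] {x | ε ≤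
      |(μ (E' k)).toReal * (((hittingTime T (E k) x).toNat : ℝ) -
        ((hittingTime T (E' k) x).toNat : ℝ))|}) atTop (𝓝 0) := by
  simp only [HittingTimesClose, tendstoInMeasure_iff_norm, sub_zero, Real.norm_eq_abs]

/-- If `E'` were null, almost every orbit would avoid it forever; but almost every point reaches
`E`, and from `Y` this needs a passage through `E'`. -/
lemma OnlyReachVia.measure_ne_zero [IsFiniteMeasure μ] (hT : Ergodic T μ) (hY : μ Y ≠ 0)
    {E E' : Set X} (hE : MeasurableSet E) (hE0 : μ E ≠ 0) (hvia : OnlyReachVia μ T Y E E') :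
    μ E' ≠ 0 := by
  intro h0
  apply hY
  have h1 : ∀ᵐ x ∂μ, ∀ j, T^[j] x ∉ E' := ae_all_iff.2 fun j =>
    (hT.toMeasurePreserving.iterate j).quasiMeasurePreserving.ae
      (measure_eq_zero_iff_ae_notMem.1 h0)
  rw [measure_eq_zero_iff_ae_notMem]
  filter_upwards [h1, ae_hittingTime_ne_top hT hE hE0, ae_all_iff.2 hvia] with x hx1 hx2 hx3 hxY
  obtain ⟨n, -, hn⟩ := hittingTime_ne_top_iff.1 hx2
  obtain ⟨j, -, hj⟩ := hx3 n hxY hn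
  exact hx1 j hj

/-- Splits `A` into points returning after more than `N` steps, whose measure is small for large
`N`, and points returning sooner. -/
lemma measure_le_inv_add [IsProbabilityMeasure μ] (hT : MeasurePreserving T μ μ) {A : Set X}
    (hA : MeasurableSet A) (hAY : A ⊆ Y) (N : ℕ) :
    μ A ≤ ((N + 1 : ℕ) : ℝ≥0∞)⁻¹ + μ (Y ∩ {x | hittingTime T A x ≤ N}) := by
  have hsub : A ⊆ (A ∩ {x | (N : ℕ∞) < hittingTime T A x}) ∪
      (Y ∩ {x | hittingTime T A x ≤ N}) := fun x hx => by
    rcases lt_or_ge (N : ℕ∞) (hittingTime T A x) with h | h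
    · exact .inl ⟨hx, h⟩
    · exact .inr ⟨hAY hx, h⟩
  refine (measure_mono hsub).trans ((measure_union_le _ _).trans ?_)
  gcongr
  rw [ENNReal.le_inv_iff_mul_le, mul_comm]
  exact measure_inter_lt_hittingTime_le hT hA N

theorem HittingTimesClose.asymptoticallyRare [IsProbabilityMeasure μ] (hT : Ergodic T μ)
    (hYm : MeasurableSet Y) (hY : μ Y ≠ 0) {E E' : ℕ → Set X} (hE : AsymptoticallyRare μ E)
    (hE'm : ∀ k, MeasurableSet (E' k)) (hE'Y : ∀ k, E' k ⊆ Y)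
    (hvia : ∀ k, OnlyReachVia μ T Y (E k) (E' k)) (h : HittingTimesClose μ T Y E E') :
    AsymptoticallyRare μ E' where
  measurableSet := hE'm
  pos k := ((hvia k).measure_ne_zero hT hY (hE.measurableSet k) (hE.pos k).ne').bot_lt
  tendsto_zero := by
    rw [ENNReal.tendsto_nhds_zero]
    intro ε hε
    by_cases hεt : ε = ∞
    · simp [hεt]
    have hε3 : 0 < ε / 3 := ENNReal.div_pos hε.ne' (by simp)
    obtain ⟨N, hN⟩ := ENNReal.exists_inv_nat_lt hε3.ne'
    have h1 : Tendsto (fun k => (N : ℝ≥0∞) * μ (E k)) atTop (𝓝 0) := by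
      simpa using ENNReal.Tendsto.const_mul (a := (N : ℝ≥0∞)) hE.tendsto_zero (.inr (by simp))
    -- The tolerance is `ε` itself: distinct hitting times differ by at least one, so if `μ (E' k) >
    -- ε` their rescaled difference is at least `ε`.
    have h2 := hittingTimesClose_iff.1 h ε.toReal (ENNReal.toReal_pos hε.ne' hεt)
    filter_upwards [ENNReal.tendsto_nhds_zero.1 h1 _ hε3, ENNReal.tendsto_nhds_zero.1 h2 _ hε3]
      with k hk1 hk2
    by_contra! hlt
    refine hlt.not_ge ((measure_le_inv_add hT.toMeasurePreserving (hE'm k) (hE'Y k) N).trans ?_)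
    set S := {x | ε.toReal ≤ |(μ (E' k)).toReal * (((hittingTime T (E k) x).toNat : ℝ) -
        ((hittingTime T (E' k) x).toNat : ℝ))|} with hS
    -- A point of `Y` that hits `E' k` within `N` steps either hits `E k` within `N` steps too,
    -- which is rare, or its two hitting times differ.
    have hcover : (Y ∩ {x | hittingTime T (E' k) x ≤ N} : Set X) ≤ᵐ[μ]
        ({x | hittingTime T (E k) x ≤ N} ∪ (Y ∩ S) : Set X) := by
      filter_upwards [ae_hittingTime_ne_top hT (hE.measurableSet k) (hE.pos k).ne'] with x hx hxY
      rcases le_or_gt (hittingTime T (E k) x) (N : ℕ∞) with hle | hgt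
      · exact .inl hle
      · refine .inr ⟨hxY.1, ?_⟩
        have hb : hittingTime T (E' k) x ≤ N := hxY.2
        obtain ⟨a, ha⟩ := ENat.ne_top_iff_exists.1 hx
        obtain ⟨b, hb'⟩ := ENat.ne_top_iff_exists.1 (ne_top_of_le_ne_top (ENat.natCast_ne_top N) hb)
        show ε.toReal ≤ _
        rw [← ha] at hgt ⊢
        rw [← hb'] at hb ⊢
        have hab : b + 1 ≤ a := by
          have h1 : N < a := by exact_mod_cast hgt
          have h2 : b ≤ N := by exact_mod_cast hb
          omega
        have hab' : (b : ℝ) + 1 ≤ a := by exact_mod_cast hab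
        have hc : ε.toReal ≤ (μ (E' k)).toReal :=
          ENNReal.toReal_mono (measure_ne_top _ _) hlt.le
        simp only [ENat.toNat_natCast]
        rw [abs_mul, abs_of_nonneg (ENNReal.toReal_nonneg), abs_of_nonneg (by linarith)]
        nlinarith [ENNReal.toReal_nonneg (a := μ (E' k))]
    have hYS : μ (Y ∩ S) ≤ μ[|Y] S := by
      rw [cond_apply hYm]
      exact le_mul_of_one_le_left (zero_le) (ENNReal.one_le_inv.2 prob_le_one)
    have hNinv : ((N + 1 : ℕ) : ℝ≥0∞)⁻¹ ≤ ε / 3 :=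
      (ENNReal.inv_le_inv.2 (by exact_mod_cast N.le_succ)).trans hN.le
    calc ((N + 1 : ℕ) : ℝ≥0∞)⁻¹ + μ (Y ∩ {x | hittingTime T (E' k) x ≤ N})
        ≤ ε / 3 + (ε / 3 + ε / 3) := by
          gcongr
          refine (measure_mono_ae hcover).trans ((measure_union_le _ _).trans ?_)
          gcongr
          · exact (measure_hittingTime_le hT.toMeasurePreserving (hE.measurableSet k) N).trans hk1
          · exact hYS.trans hk2
      _ = ε := by rw [← add_assoc, ENNReal.add_thirds]

/-- The rescaled hitting times of `E` and of `E'` are asymptotically equal. -/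
lemma HittingTimesClose.tendsto_measure_compactify [IsProbabilityMeasure μ] (hT : Ergodic T μ)
    {E E' : ℕ → Set X} (hE : AsymptoticallyRare μ E) (hE' : AsymptoticallyRare μ E')
    (h : HittingTimesClose μ T Y E E') {ε : ℝ} (hε : 0 < ε) :
    Tendsto (fun k => μ[|Y] {x | ε ≤ |compactify (μ (E' k) * (hittingTime T (E' k) x : ℝ≥0∞)) -
      compactify (μ (E' k) * (hittingTime T (E k) x : ℝ≥0∞))|}) atTop (𝓝 0) := by
  refine tendsto_of_tendsto_of_tendsto_of_le_of_le tendsto_const_nhds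
    (hittingTimesClose_iff.1 h ε hε) (fun _ => zero_le) fun k => measure_mono_ae ?_
  have hac : μ[|Y] ≪ μ := cond_absolutelyContinuous
  filter_upwards [hac.ae_le (ae_hittingTime_ne_top hT (hE.measurableSet k) (hE.pos k).ne'),
    hac.ae_le (ae_hittingTime_ne_top hT (hE'.measurableSet k) (hE'.pos k).ne')] with x hx hx' hxε
  have hxε' : ε ≤ |_| := hxε
  rw [mul_coe_eq_ofReal (measure_ne_top _ _) hx, mul_coe_eq_ofReal (measure_ne_top _ _) hx'] at hxε'
  refine hxε'.trans ((abs_compactify_sub_le (by positivity) (by positivity)).trans_eq ?_)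
  rw [mul_sub, abs_sub_comm]

/-- Rescaled hitting times of rare events are asymptotically invariant. -/
lemma tendsto_measure_compactify_comp [IsProbabilityMeasure μ] (hT : Ergodic T μ)
    {E : ℕ → Set X} (hE : AsymptoticallyRare μ E) {c : ℕ → ℝ≥0∞} (hct : ∀ k, c k ≠ ∞)
    (hc : Tendsto c atTop (𝓝 0)) {ε : ℝ} (hε : 0 < ε) :
    Tendsto (fun k => μ {x | ε ≤ |compactify (c k * (hittingTime T (E k) (T x) : ℝ≥0∞)) -
      compactify (c k * (hittingTime T (E k) x : ℝ≥0∞))|}) atTop (𝓝 0) := by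
  have hcr : Tendsto (fun k => (c k).toReal) atTop (𝓝 0) := by
    simpa [Function.comp_def] using (ENNReal.tendsto_toReal ENNReal.zero_ne_top).comp hc
  refine tendsto_of_tendsto_of_tendsto_of_le_of_le' tendsto_const_nhds hE.tendsto_zero
    (.of_forall fun _ => zero_le) ?_
  -- Once `c k < ε`, only `T ⁻¹' E k` can be bad: elsewhere the two rescaled times differ by exactly
  -- `c k`.
  filter_upwards [hcr.eventually_lt_const hε] with k hk
  rw [← hT.toMeasurePreserving.measure_preimage (hE.measurableSet k).nullMeasurableSet]
  refine measure_mono_ae ?_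
  filter_upwards [ae_hittingTime_ne_top hT (hE.measurableSet k) (hE.pos k).ne'] with x hx hxε
  by_contra hxE
  have hrec := hittingTime_eq_comp_add_one (show T x ∉ E k from hxE)
  have hx' : hittingTime T (E k) (T x) ≠ ⊤ := fun h => hx (by rw [hrec, h]; rfl)
  have hxε' : ε ≤ |_| := hxε
  rw [mul_coe_eq_ofReal (hct k) hx, mul_coe_eq_ofReal (hct k) hx'] at hxε'
  have h1 := hxε'.trans (abs_compactify_sub_le (by positivity) (by positivity))
  rw [hrec, ENat.toNat_add hx' (by simp)] at h1
  push_cast at h1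
  rw [← mul_sub, sub_add_cancel_left, abs_mul, abs_of_nonneg ENNReal.toReal_nonneg] at h1
  simp at h1
  linarith

/-- Rescaled hitting times of rare events under `T` and under the first-return map are
asymptotically equal. -/
lemma tendsto_measure_compactify_induced [IsProbabilityMeasure μ] (hT : Ergodic T μ)
    (hYm : MeasurableSet Y) (hY : μ Y ≠ 0) {A : ℕ → Set X} (hA : AsymptoticallyRare μ A)
    (hAY : ∀ k, A k ⊆ Y) {ε : ℝ} (hε : 0 < ε) :
    Tendsto (fun k => μ {x | ε ≤
      |compactify (μ[|Y] (A k) * (inducedHittingTime T Y (A k) x : ℝ≥0∞)) -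
        compactify (μ (A k) * (hittingTime T (A k) x : ℝ≥0∞))|}) atTop (𝓝 0) := by
  classical
  have hm0 : 0 < (μ Y).toReal := ENNReal.toReal_pos hY (measure_ne_top _ _)
  set m := (μ Y).toReal with hm
  -- The preimage shifts the index: hitting times start at time `1`, so the Birkhoff sums must count
  -- visits at times `1, …, n`.
  set f : X → ℝ := (T ⁻¹' Y).indicator 1 with hf
  have hTY : MeasurableSet (T ⁻¹' Y) := hT.measurable hYm
  have hfm : Measurable f := measurable_one.indicator hTY
  have hfi : Integrable f μ := (integrable_const (1 : ℝ)).indicator hTY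
  have hfint : ∫ x, f x ∂μ = m := by
    rw [hf, integral_indicator_one hTY, Measure.real,
      hT.toMeasurePreserving.measure_preimage hYm.nullMeasurableSet]
  have hcount : ∀ n x, birkhoffSum T f n x =
      ((Finset.range n).filter fun i => T^[i + 1] x ∈ Y).card := by
    intro n x
    rw [Finset.natCast_card_filter]
    refine Finset.sum_congr rfl fun i _ => ?_
    rw [hf, Set.indicator_apply, Set.mem_preimage, ← Function.iterate_succ_apply' T]
    rfl
  have hbm : ∀ n, Measurable (birkhoffAverage ℝ T f n) := fun n =>
    (Finset.measurable_sum _ fun i _ => hfm.comp (hT.measurable.iterate i)).const_smul (n : ℝ)⁻¹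
  -- The union over all `n ≥ N` is needed because the average is evaluated at the hitting time,
  -- which depends on the point.
  let B : ℕ → Set X := fun N => ⋃ n ≥ N, {x | ε ≤ |birkhoffAverage ℝ T f n x / m - 1|}
  have hBm : ∀ N, MeasurableSet (B N) := fun N => MeasurableSet.iUnion fun n =>
    MeasurableSet.iUnion fun _ =>
      measurableSet_le measurable_const (((hbm n).div_const m).sub_const 1).abs
  have hBanti : Antitone B := fun N N' h => Set.iUnion_mono fun n =>
    Set.iUnion_mono' fun hn => ⟨h.trans hn, le_rfl⟩
  have hBnull : μ (⋂ N, B N) = 0 := by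
    rw [measure_eq_zero_iff_ae_notMem]
    filter_upwards [ae_tendsto_birkhoffAverage hT hfm hfi] with x hx hxB
    rw [hfint] at hx
    have h1 : Tendsto (fun n => |birkhoffAverage ℝ T f n x / m - 1|) atTop (𝓝 0) := by
      simpa [div_self hm0.ne'] using ((hx.div_const m).sub_const 1).abs
    obtain ⟨N, hN⟩ := eventually_atTop.1 (h1.eventually_lt_const hε)
    have h2 := Set.mem_iInter.1 hxB N
    simp only [B, Set.mem_iUnion] at h2
    obtain ⟨n, hn, h3⟩ := h2
    exact (hN n hn).not_ge h3
  have hBlim : Tendsto (fun N => μ (B N)) atTop (𝓝 0) := by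
    rw [← hBnull]
    exact tendsto_measure_iInter_atTop (fun N => (hBm N).nullMeasurableSet) hBanti
      ⟨0, measure_ne_top _ _⟩
  have hbound : ∀ N k, μ {x | ε ≤
      |compactify (μ[|Y] (A k) * (inducedHittingTime T Y (A k) x : ℝ≥0∞)) -
        compactify (μ (A k) * (hittingTime T (A k) x : ℝ≥0∞))|} ≤ μ (B N) + N * μ (A k) := by
    intro N k
    refine le_trans (measure_mono_ae (?_ : _ ≤ᵐ[μ] (B N ∪ {x | hittingTime T (A k) x ≤ N} : Set X)))
      ((measure_union_le _ _).trans (by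
        gcongr
        exact measure_hittingTime_le hT.toMeasurePreserving (hA.measurableSet k) N))
    filter_upwards [ae_hittingTime_ne_top hT (hA.measurableSet k) (hA.pos k).ne'] with x hx hxε
    rcases le_or_gt (hittingTime T (A k) x) (N : ℕ∞) with hle | hgt
    · exact .inr hle
    left
    obtain ⟨n, hn⟩ := ENat.ne_top_iff_exists.1 hx
    have hNn : N < n := by rw [← hn] at hgt; exact_mod_cast hgt
    have hn0 : (0 : ℝ) < n := by exact_mod_cast (Nat.zero_le N).trans_lt hNn
    have hind := inducedHittingTime_eq_card (hAY k) hn.symm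
    have hcond : μ[|Y] (A k) = (μ Y)⁻¹ * μ (A k) := by
      rw [cond_apply hYm, Set.inter_eq_self_of_subset_right (hAY k)]
    have hxε' : ε ≤ |_| := hxε
    rw [mul_coe_eq_ofReal (measure_ne_top _ _) hx,
      mul_coe_eq_ofReal (hcond ▸ ENNReal.mul_ne_top (by simpa using hY) (measure_ne_top _ _))
        (by rw [hind]; exact ENat.natCast_ne_top _), hcond, hind, ← hn] at hxε'
    simp only [ENat.toNat_natCast, ← hcount] at hxε'
    -- The induced time, rescaled, is the original one times the relative frequency of visits to
    -- `Y`, a factor near `1` off `B N`.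
    have hr : ((μ Y)⁻¹ * μ (A k)).toReal * birkhoffSum T f n x =
        (μ (A k)).toReal * n * (birkhoffAverage ℝ T f n x / m) := by
      rw [ENNReal.toReal_mul, ENNReal.toReal_inv, birkhoffAverage, smul_eq_mul, ← hm]
      field_simp
    rw [hr] at hxε'
    have hav : 0 ≤ birkhoffAverage ℝ T f n x := by
      rw [birkhoffAverage, hcount, smul_eq_mul]
      positivity
    refine Set.mem_iUnion₂.2 ⟨n, hNn.le, hxε'.trans ?_⟩
    exact abs_compactify_mul_sub_le (by positivity) (by positivity)
  rw [ENNReal.tendsto_nhds_zero]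
  intro δ hδ
  obtain ⟨N, hN⟩ := (ENNReal.tendsto_nhds_zero.1 hBlim (δ / 2) (ENNReal.half_pos hδ.ne')).exists
  have h1 : Tendsto (fun k => (N : ℝ≥0∞) * μ (A k)) atTop (𝓝 0) := by
    simpa using ENNReal.Tendsto.const_mul (a := (N : ℝ≥0∞)) hA.tendsto_zero (.inr (by simp))
  filter_upwards [ENNReal.tendsto_nhds_zero.1 h1 (δ / 2) (ENNReal.half_pos hδ.ne')] with k hk
  exact (hbound N k).trans ((add_le_add hN hk).trans_eq (ENNReal.add_halves δ))

theorem hittingTimesClose_of_subset_iUnion [IsProbabilityMeasure μ] (hT : Ergodic T μ)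
    (hYm : MeasurableSet Y) (hY : μ Y ≠ 0) {E E' : ℕ → Set X} (hE : AsymptoticallyRare μ E)
    (hE'm : ∀ k, MeasurableSet (E' k)) (hvia : ∀ k, OnlyReachVia μ T Y (E k) (E' k))
    {M : ℕ} (hM : ∀ k, E' k ⊆ ⋃ m ≤ M, T^[m] ⁻¹' E k) : HittingTimesClose μ T Y E E' := by
  have hle : ∀ k, μ (E' k) ≤ ((M + 1 : ℕ) : ℝ≥0∞) * μ (E k) := by
    intro k
    have hsub : E' k ⊆ ⋃ m ∈ Finset.range (M + 1), T^[m] ⁻¹' E k := fun x hx => by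
      simpa [Nat.lt_succ_iff] using hM k hx
    refine (measure_mono hsub).trans ((measure_biUnion_finset_le _ _).trans ?_)
    simp_rw [(hT.toMeasurePreserving.iterate _).measure_preimage
      (hE.measurableSet k).nullMeasurableSet]
    simp
  have hlim : Tendsto (fun k => μ (E' k)) atTop (𝓝 0) := by
    have h := ENNReal.Tendsto.const_mul (a := ((M + 1 : ℕ) : ℝ≥0∞)) hE.tendsto_zero
      (.inr (ENNReal.natCast_ne_top _))
    rw [mul_zero] at h
    exact tendsto_of_tendsto_of_tendsto_of_le_of_le tendsto_const_nhds h (fun _ => zero_le) hle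
  have hlimr : Tendsto (fun k => (μ (E' k)).toReal * M) atTop (𝓝 0) := by
    simpa using ((ENNReal.tendsto_toReal ENNReal.zero_ne_top).comp hlim).mul_const (M : ℝ)
  rw [hittingTimesClose_iff]
  intro ε hε
  refine tendsto_of_tendsto_of_tendsto_of_le_of_le' tendsto_const_nhds
    (tendsto_cond_zero hYm hY hlim) (.of_forall fun _ => zero_le) ?_
  filter_upwards [hlimr.eventually_lt_const hε] with k hk
  refine measure_mono_ae ?_
  have hac : μ[|Y] ≪ μ := cond_absolutelyContinuous
  have hE'0 := (hvia k).measure_ne_zero hT hY (hE.measurableSet k) (hE.pos k).ne'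
  filter_upwards [hac.ae_le (ae_hittingTime_ne_top hT (hE.measurableSet k) (hE.pos k).ne'),
    hac.ae_le (ae_hittingTime_ne_top hT (hE'm k) hE'0), hac.ae_le (ae_all_iff.2 (hvia k)),
    ae_cond_mem hYm] with x hx hx' hxvia hxY hxε
  -- Points of `E' k` itself are discarded, at a cost tending to zero: there the passage through `E'
  -- k` may occur at time `0`, which the hitting time ignores.
  by_contra hxE'
  obtain ⟨a, ha⟩ := ENat.ne_top_iff_exists.1 hx
  obtain ⟨b, hb⟩ := ENat.ne_top_iff_exists.1 hx'
  obtain ⟨-, haE, hamin⟩ := hittingTime_eq_natCast_iff.1 ha.symm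
  obtain ⟨hb1, hbE, hbmin⟩ := hittingTime_eq_natCast_iff.1 hb.symm
  have hba : b ≤ a := by
    obtain ⟨j, hja, hj⟩ := hxvia a hxY haE
    by_contra! hlt
    rcases j.eq_zero_or_pos with rfl | hj0
    · exact hxE' hj
    · exact hbmin j hj0 (hja.trans_lt hlt) hj
  -- At time `b` the orbit is in `E' k`, hence in `E k` at most `M` steps later; `m = 0` is harmless
  -- since `b ≥ 1`.
  have hab : a ≤ b + M := by
    obtain ⟨m, hmM, hm⟩ := Set.mem_iUnion₂.1 (hM k hbE)
    by_contra! hlt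
    refine hamin (m + b) (by omega) (by omega) ?_
    rwa [Function.iterate_add_apply]
  have hxε' : ε ≤ |_| := hxε
  rw [← ha, ← hb, ENat.toNat_natCast, ENat.toNat_natCast, abs_mul, abs_of_nonneg ENNReal.toReal_nonneg,
    abs_of_nonneg (by have : (b : ℝ) ≤ a := by exact_mod_cast hba
                      linarith)] at hxε'
  have hab' : (a : ℝ) - b ≤ M := by
    have : (a : ℝ) ≤ b + M := by exact_mod_cast hab
    linarith
  have := mul_le_mul_of_nonneg_left hab' (ENNReal.toReal_nonneg (a := μ (E' k)))
  linarith

end Main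

end HittingTimes

theorem mainTheorem2 {X : Type*} [MeasurableSpace X] (μ : Measure X) [IsProbabilityMeasure μ]
    (T : X → X) (hT : Ergodic T μ)
    (E : ℕ → Set X) (hE : HittingTimes.AsymptoticallyRare μ E)
    (Y : Set X) (hYm : MeasurableSet Y) (hY : μ Y ≠ 0)
    (E' : ℕ → Set X) (hE'm : ∀ k, MeasurableSet (E' k)) (hE'Y : ∀ k, E' k ⊆ Y)
    (hvia : ∀ k, HittingTimes.OnlyReachVia μ T Y (E k) (E' k))
    {Ω : Type*} [MeasurableSpace Ω] (P : Measure Ω) [IsProbabilityMeasure P]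
    (R : Ω → ℝ≥0∞) (hR : Measurable R) :
    haveI : IsProbabilityMeasure μ[|Y] := cond_isProbabilityMeasure hY
    (HittingTimes.HittingTimesClose μ T Y E E' →
      HittingTimes.AsymptoticallyRare μ E' ∧
      (TendstoInDistribution
          (fun k x => μ[|Y] (E' k) * (HittingTimes.inducedHittingTime T Y (E' k) x : ℝ≥0∞))
          atTop R (fun _ => μ[|Y]) P ↔
        TendstoInDistribution
          (fun k x => μ (E' k) * (HittingTimes.hittingTime T (E k) x : ℝ≥0∞))
          atTop R (fun _ => μ) P)) ∧
    ((∃ M : ℕ, ∀ k, E' k ⊆ ⋃ m ≤ M, T^[m] ⁻¹' E k) →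
      HittingTimes.HittingTimesClose μ T Y E E') := by

  have : IsProbabilityMeasure μ[|Y] := cond_isProbabilityMeasure hY
  refine ⟨fun hclose => ?_, fun ⟨M, hM⟩ =>
    HittingTimes.hittingTimesClose_of_subset_iUnion hT hYm hY hE hE'm hvia hM⟩
  have hE' := hclose.asymptoticallyRare hT hYm hY hE hE'm hE'Y hvia
  have hm := fun A hA => HittingTimes.measurable_hittingTime (A := A) hT.measurable hA
  refine ⟨hE', ?_⟩
  -- The right side moves from `μ` to `μ[|Y]`, then from `E k` to `E' k`; what remains compares the
  -- induced and original hitting times of `E' k` under `μ[|Y]`.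
  rw [← HittingTimes.tendstoInDistribution_cond_iff hT hYm hY
      (fun k => HittingTimes.measurable_mul_coe (hm _ (hE.measurableSet k)))
      fun ε hε => HittingTimes.tendsto_measure_compactify_comp hT hE
        (fun k => measure_ne_top _ _) hE'.tendsto_zero hε,
    ← HittingTimes.tendstoInDistribution_congr_of_tendstoInMeasure
      (fun k => (HittingTimes.measurable_mul_coe (hm _ (hE'm k))).aemeasurable)
      (fun k => (HittingTimes.measurable_mul_coe (hm _ (hE.measurableSet k))).aemeasurable)
      fun ε hε => hclose.tendsto_measure_compactify hT hE hE' hε]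
  exact HittingTimes.tendstoInDistribution_congr_of_tendstoInMeasure
    (fun k => (HittingTimes.measurable_mul_coe
      (HittingTimes.measurable_inducedHittingTime hT.measurable hYm (hE'm k))).aemeasurable)
    (fun k => (HittingTimes.measurable_mul_coe (hm _ (hE'm k))).aemeasurable)
    fun ε hε => HittingTimes.tendsto_cond_zero hYm hY
      (HittingTimes.tendsto_measure_compactify_induced hT hYm hY hE' hE'Y hε)
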